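/- For an $n\times n$ complex matrix $A$ let $\|A\|_2$ be the operator norm induced by the Euclidean norm and $W(A)=\{q^*Aq:\ q\in\mathbb{C}^n,\ \|q\|_2=1\}$ its numerical range. Let $\phi$ be a conformal map of the interior of $W(A)$ onto the open unit disk that is continuous on $W(A)$. A Blaschke product of degree $m\ge 0$ is a function $B(z)=e^{i\gamma}\prod_{j=1}^m\frac{z-\alpha_j}{1-\overline{\alpha_j}z}$ with $\gamma\in\mathbb{R}$ and $|\alpha_j|<1$. It is called extremal (for $A$ and $\phi$) if $\hat f=B\circ\phi$ maximizes $\|f(A)\|_2$ over the class $\mathcal{A}(A)$ of all functions $f$ that are continuous on $W(A)$, analytic in its interior and satisfy $\max_{W(A)}|f|\le 1$. Uniqueness of extremal Blaschke products is always meant up to a constant factor of modulus one. Let $t\in[0,\sqrt3-1]$, $$A=\begin{pmatrix}0&1&0\\0&0&1-t\\0&0&0\end{pmatrix},\qquad r=\frac{\sqrt{1+(1-t)^2}}{2},\qquad t_0=1-\frac1{\sqrt3}\in[0,\sqrt3-1].$$ Then: (a) $W(A)$ is the closed disk of radius $r$ centred at $0$, $\phi(z)=z/r$ maps its interior conformally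 onto the unit disk, $\phi(A)=A/r$, and $B(\phi(A))=(B\circ\phi)(A)$ for every Blaschke product $B$. (b) $\max_B\|B(\phi(A))\|_2=\max\left(\frac1r,\frac{1-t}{r^2}\right)$, the maximum being over all Blaschke products of finite degree, and this is also the maximum of $\|f(A)\|_2$ over $f\in\mathcal{A}(A)$. For $B_1(z)=z$ and $B_2(z)=z^2$ one has $\|B_1(\phi(A))\|_2=\frac1r$ and $\|B_2(\phi(A))\|_2=\frac{1-t}{r^2}$. (c) For $t\le t_0$ the Blaschke product $z^2$ is extremal, and for $t<t_0$ it is the only extremal Blaschke product (in particular all extremal ones have degree $2$). For $t\ge t_0$ the Blaschke product $z$ is extremal, and for $t>t_0$ it is the only extremal one; in particular, for $t\in(t_0,\sqrt3-1]$ every extremal Blaschke product has degree $1$, which is less than $n-1=2$. (d) For $t=t_0$ both $z$ and $z^2$ are extremal, with $\|B_1(\phi(A))\|_2=\|B_2(\phi(A))\|_2=\sqrt3$. As $z$ and $z^2$ are not multiples of each other by a constant of modulus one, the extremal Blaschke product is not unique. -/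

import Mathlib

open scoped Matrix.Norms.L2Operator

/-- The numerical range `W(A) = {q* A q : ‖q‖₂ = 1}`. -/
def numRange {n : ℕ} (A : Matrix (Fin n) (Fin n) ℂ) : Set ℂ :=
  {w | ∃ q : EuclideanSpace ℂ (Fin n), ‖q‖ = 1 ∧ w = star q.ofLp ⬝ᵥ (A.mulVec q.ofLp)}

/-- `p` interpolates `f` on the spectrum of `A` in the sense of Hermite: `p` and `f` have the
same derivatives of order `k` at `z` for all `k` below the multiplicity of `z` as a root of the
minimal polynomial of `A`. -/
def IsHermiteInterpolant {n : ℕ} (f : ℂ → ℂ) (A : Matrix (Fin n) (Fin n) ℂ)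
    (p : Polynomial ℂ) : Prop :=
  ∀ z : ℂ, ∀ k < (minpoly ℂ A).rootMultiplicity z,
    (Polynomial.derivative^[k] p).eval z = iteratedDeriv k f z

/-- The matrix function `f(A)`, that is `p(A)` for any Hermite interpolant `p` of `f` on the
spectrum of `A`. -/
noncomputable def matFun {n : ℕ} (f : ℂ → ℂ) (A : Matrix (Fin n) (Fin n) ℂ) :
    Matrix (Fin n) (Fin n) ℂ :=
  Polynomial.aeval A (Classical.epsilon (IsHermiteInterpolant f A))

/-- `f(A)` does not depend on the interpolant. -/
theorem matFun_eq_aeval {n : ℕ} (f : ℂ → ℂ) (A : Matrix (Fin n) (Fin n) ℂ) (p : Polynomial ℂ)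
    (hp : IsHermiteInterpolant f A p) : matFun f A = Polynomial.aeval A p := by
  have hq : IsHermiteInterpolant f A (Classical.epsilon (IsHermiteInterpolant f A)) :=
    Classical.epsilon_spec ⟨p, hp⟩
  unfold matFun
  generalize Classical.epsilon (IsHermiteInterpolant f A) = q at hq
  rw [← sub_eq_zero, ← map_sub]
  by_cases h0 : q - p = 0
  · simp [h0]
  have hm : minpoly ℂ A ≠ 0 := minpoly.ne_zero (Matrix.isIntegral A)
  have hd : minpoly ℂ A ∣ q - p := by
    refine ((IsAlgClosed.splits (minpoly ℂ A)).dvd_iff_roots_le_roots hm h0).2 ?_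
    rw [Multiset.le_iff_count]
    intro z
    rw [Polynomial.count_roots, Polynomial.count_roots]
    rcases Nat.eq_zero_or_pos ((minpoly ℂ A).rootMultiplicity z) with h | h
    · omega
    · have := (Polynomial.lt_rootMultiplicity_iff_isRoot_iterate_derivative h0
        (t := z) (n := (minpoly ℂ A).rootMultiplicity z - 1)).2 (by
          intro k hk
          rw [Polynomial.IsRoot, Polynomial.iterate_derivative_sub, Polynomial.eval_sub,
            hq z k (by omega), hp z k (by omega), sub_self])
      omega
  exact (minpoly.dvd_iff).1 hd

/-- The functions that are continuous on `W(A)`, analytic in its interior and bounded by `1` in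
modulus on `W(A)`. -/
def admissible {n : ℕ} (A : Matrix (Fin n) (Fin n) ℂ) : Set (ℂ → ℂ) :=
  {f | ContinuousOn f (numRange A) ∧ DifferentiableOn ℂ f (interior (numRange A)) ∧
    ∀ z ∈ numRange A, ‖f z‖ ≤ 1}

/-- `φ` maps the interior of `W` conformally onto the open unit disk and is continuous on `W`. -/
def IsConformalOntoDisk (φ : ℂ → ℂ) (W : Set ℂ) : Prop :=
  ContinuousOn φ W ∧ DifferentiableOn ℂ φ (interior W) ∧
    Set.BijOn φ (interior W) (Metric.ball 0 1)

/-- `B` is a Blaschke product of degree `m`. -/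
def IsBlaschke (m : ℕ) (B : ℂ → ℂ) : Prop :=
  ∃ (γ : ℝ) (α : Fin m → ℂ), (∀ j, ‖α j‖ < 1) ∧
    B = fun z => Complex.exp (Complex.I * γ) *
      ∏ j, (z - α j) / (1 - (starRingEnd ℂ) (α j) * z)

/-- `B` is an extremal Blaschke product of degree `m` for `A` and the conformal map `φ`: the
function `f = B ∘ φ` maximizes `‖f(A)‖₂` among all admissible functions. -/
def IsExtremalBlaschke {n : ℕ} (A : Matrix (Fin n) (Fin n) ℂ) (φ : ℂ → ℂ) (m : ℕ)
    (B : ℂ → ℂ) : Prop :=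
  IsBlaschke m B ∧ B ∘ φ ∈ admissible A ∧
    ∀ f ∈ admissible A, ‖matFun f A‖ ≤ ‖matFun (B ∘ φ) A‖

/-- Two functions agree on the closed unit disk up to a scalar factor of modulus one. -/
def EqUpToUnimodular (B C : ℂ → ℂ) : Prop :=
  ∃ c : ℂ, ‖c‖ = 1 ∧ ∀ z ∈ Metric.closedBall (0 : ℂ) 1, B z = c * C z

/-- Any two extremal Blaschke products agree up to a scalar factor of modulus one. -/
def ExtremalBlaschkeUnique {n : ℕ} (A : Matrix (Fin n) (Fin n) ℂ) (φ : ℂ → ℂ) : Prop :=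
  ∀ (m₁ m₂ : ℕ) (B₁ B₂ : ℂ → ℂ), IsExtremalBlaschke A φ m₁ B₁ → IsExtremalBlaschke A φ m₂ B₂ →
    EqUpToUnimodular B₁ B₂

/-- The matrix of the example. -/
noncomputable def exA (t : ℝ) : Matrix (Fin 3) (Fin 3) ℂ :=
  !![0, 1, 0; 0, 0, 1 - (t : ℂ); 0, 0, 0]

/-- The radius `r = √(1 + (1 - t)²) / 2`. -/
noncomputable def exR (t : ℝ) : ℝ := √(1 + (1 - t) ^ 2) / 2

/-- The conformal map `φ(z) = z / r`. -/
noncomputable def exPhi (t : ℝ) : ℂ → ℂ := fun z => (1 / (exR t : ℂ)) * z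

/-! For `t ≠ 1` the matrix `A` is nilpotent of index three, so `f(A) = a₀ + a₁A + a₂A²` with the
Taylor coefficients of `f` at `0`. Put `P = 1/r`, `Q = (1-t)/r²`, `D = diag(1, P, Q)`, and let `S`
be the nilpotent shift. Then `A/r = D⁻¹SD`, hence `f(A) = D⁻¹TD` with `T` the upper triangular
Toeplitz matrix of `g(z) = f(rz)`.

Since `|g| ≤ 1` on the closed disk, `T` is a contraction (`taylor_toeplitz_contraction`). As `1 < P`
and `1 ≤ Q` on the given interval, `‖f(A)‖` is at most the condition number `max(P, Q)` of `D`
(`norm_matFun_exA_le`). The functions `z` and `z²` attain `P` and `Q`, and `P < Q` exactly when `t <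
t₀`.

For `P ≠ Q`, equality forces a norming vector of `f(A)` onto one coordinate axis. This fixes the low
Taylor coefficients of `B`: `B(0) = 0` and `|B'(0)| = 1`, or `B(0) = B'(0) = 0` and `|B''(0)/2| =
1`. Splitting off factors `z` shows that such a Blaschke product is a unimodular multiple of `z` or
`z²`. -/

/-! ### Taylor coefficients of bounded functions on the disk -/

theorem Polynomial.iteratedDeriv_eval (P : Polynomial ℂ) (k : ℕ) (z : ℂ) :
    iteratedDeriv k (fun w => P.eval w) z = (Polynomial.derivative^[k] P).eval z := by
  induction k generalizing P with
  | zero => simp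
  | succ k ih =>
    rw [iteratedDeriv_succ', Function.iterate_succ_apply, ← ih]
    congr 1
    ext w
    exact P.deriv

/-- Cauchy's formula for the second Taylor coefficient, as an average over the unit circle. -/
theorem circleAverage_inv_sq_mul {G : ℂ → ℂ} (hG : DiffContOnCl ℂ G (Metric.ball 0 1)) :
    Real.circleAverage (fun z => (z ^ 2)⁻¹ * G z) 0 1 = iteratedDeriv 2 G 0 / 2 := by
  have h := hG.circleIntegral_one_div_sub_center_pow_smul one_pos 2
  rw [Real.circleAverage_eq_circleIntegral one_ne_zero]
  have e : (fun z : ℂ => (z - 0)⁻¹ • ((z ^ 2)⁻¹ * G z)) =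
      fun z => (1 / (z - 0) ^ (2 + 1)) • G z := by
    ext z
    simp only [smul_eq_mul, sub_zero, one_div, pow_succ, mul_inv]
    ring
  rw [e, h]
  have : (Real.pi : ℂ) ≠ 0 := by exact_mod_cast Real.pi_ne_zero
  have := Complex.I_ne_zero
  simp only [smul_eq_mul, Nat.factorial]
  push_cast
  field_simp

/-- The average extracts the `z²` coefficient of `gP`, which the Leibniz rule expands. On the circle
the pairing of `gH` with a quadratic `K` has this form. -/
theorem circleAverage_inv_sq_mul_mul_polynomial {g : ℂ → ℂ}
    (hg : DiffContOnCl ℂ g (Metric.ball 0 1)) (P : Polynomial ℂ) :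
    Real.circleAverage (fun z => (z ^ 2)⁻¹ * (g z * P.eval z)) 0 1 =
      iteratedDeriv 2 g 0 / 2 * P.coeff 0 + deriv g 0 * P.coeff 1 + g 0 * P.coeff 2 := by
  have hP : DiffContOnCl ℂ (fun z => P.eval z) (Metric.ball 0 1) :=
    P.differentiable.diffContOnCl
  have := circleAverage_inv_sq_mul (hg.smul hP)
  have e : (fun z => g z • P.eval z) = g * fun z => P.eval z := rfl
  rw [e, iteratedDeriv_mul] at this
  · refine Eq.trans this ?_
    simp [Finset.sum_range_succ, Polynomial.iteratedDeriv_eval, ← Polynomial.coeff_zero_eq_eval_zero,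
      Polynomial.coeff_derivative, iteratedDeriv_one]
    ring
  · exact (hg.differentiableOn.contDiffOn Metric.isOpen_ball).contDiffAt
      (Metric.isOpen_ball.mem_nhds (by simp))
  · exact P.contDiff_aeval 2 |>.contDiffAt
open Polynomial in
/-- A function bounded by one on the unit disk gives a contractive upper triangular Toeplitz
matrix of Taylor coefficients. -/
theorem taylor_toeplitz_contraction {g : ℂ → ℂ} (hg : DiffContOnCl ℂ g (Metric.ball 0 1))
    (hb : ∀ z ∈ Metric.closedBall (0 : ℂ) 1, ‖g z‖ ≤ 1) (v₁ v₂ v₃ : ℂ) :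
    ‖g 0 * v₁ + deriv g 0 * v₂ + iteratedDeriv 2 g 0 / 2 * v₃‖ ^ 2 +
        ‖g 0 * v₂ + deriv g 0 * v₃‖ ^ 2 + ‖g 0 * v₃‖ ^ 2 ≤
      ‖v₁‖ ^ 2 + ‖v₂‖ ^ 2 + ‖v₃‖ ^ 2 := by
  set a₀ := g 0
  set a₁ := deriv g 0
  set a₂ := iteratedDeriv 2 g 0 / 2
  set u₁ := a₀ * v₁ + a₁ * v₂ + a₂ * v₃ with hu₁
  set u₂ := a₀ * v₂ + a₁ * v₃ with hu₂
  set u₃ := a₀ * v₃ with hu₃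
  -- `p` encodes a vector as a quadratic in reversed order, so that the `u`'s are the coefficients
  -- of `g · p v` modulo `X³`; `p'` is its conjugate reciprocal.
  let p (x y z : ℂ) : ℂ[X] := C z + C y * X + C x * X ^ 2
  let p' (x y z : ℂ) : ℂ[X] :=
    C (starRingEnd ℂ x) + C (starRingEnd ℂ y) * X + C (starRingEnd ℂ z) * X ^ 2
  have hc (x y z x' y' z' : ℂ) : p x y z * p' x' y' z' =
      C (z * starRingEnd ℂ x') + C (y * starRingEnd ℂ x' + z * starRingEnd ℂ y') * X +
      C (x * starRingEnd ℂ x' + y * starRingEnd ℂ y' + z * starRingEnd ℂ z') * X ^ 2 +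
      C (x * starRingEnd ℂ y' + y * starRingEnd ℂ z') * X ^ 3 +
      C (x * starRingEnd ℂ z') * X ^ 4 := by
    simp only [p, p', C_add, C_mul]; ring
  have c0 (x y z x' y' z' : ℂ) : (p x y z * p' x' y' z').coeff 0 = z * starRingEnd ℂ x' := by
    rw [hc]; simp [coeff_X, coeff_X_pow]
  have c1 (x y z x' y' z' : ℂ) : (p x y z * p' x' y' z').coeff 1 =
      y * starRingEnd ℂ x' + z * starRingEnd ℂ y' := by
    rw [hc]; simp only [coeff_add, coeff_C_mul, coeff_X, coeff_X_pow, coeff_C]; norm_num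
  have c2 (x y z x' y' z' : ℂ) : (p x y z * p' x' y' z').coeff 2 =
      x * starRingEnd ℂ x' + y * starRingEnd ℂ y' + z * starRingEnd ℂ z' := by
    rw [hc]; simp only [coeff_add, coeff_C_mul, coeff_X, coeff_X_pow, coeff_C]; norm_num
  -- On the unit circle `conj w = w⁻¹`, so conjugating a quadratic reverses its coefficients up to
  -- the factor `w⁻²`.
  have hrefl {w : ℂ} (hw : w ∈ Metric.sphere (0 : ℂ) |1|) (x y z : ℂ) :
      (w ^ 2)⁻¹ * (p' x y z).eval w = starRingEnd ℂ ((p x y z).eval w) := by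
    have hw1 : w * starRingEnd ℂ w = 1 := by
      rw [Complex.mul_conj, Complex.normSq_eq_norm_sq]; simp_all
    have hw0 : w ≠ 0 := left_ne_zero_of_mul_eq_one hw1
    rw [inv_mul_eq_iff_eq_mul₀ (pow_ne_zero 2 hw0)]
    simp only [p, p', eval_add, eval_C, eval_mul, eval_X, eval_pow, map_add, map_mul, map_pow]
    linear_combination (-(starRingEnd ℂ y * w) - starRingEnd ℂ x * (1 + w * starRingEnd ℂ w)) * hw1
  have h1 := circleAverage_inv_sq_mul_mul_polynomial
    (diffContOnCl_const (c := (1 : ℂ)) (s := Metric.ball (0 : ℂ) 1)) (p v₁ v₂ v₃ * p' v₁ v₂ v₃)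
  have h2 := circleAverage_inv_sq_mul_mul_polynomial
    (diffContOnCl_const (c := (1 : ℂ)) (s := Metric.ball (0 : ℂ) 1)) (p u₁ u₂ u₃ * p' u₁ u₂ u₃)
  have h3 := circleAverage_inv_sq_mul_mul_polynomial hg (p v₁ v₂ v₃ * p' u₁ u₂ u₃)
  rw [c0, c1, c2] at h1 h2 h3
  simp only [iteratedDeriv_const, deriv_const] at h1 h2
  have hgc : ContinuousOn g (Metric.sphere 0 |1|) := by
    have := hg.continuousOn_ball
    exact this.mono (by simpa using Metric.sphere_subset_closedBall)
  have hci {f : ℂ → ℂ} (hf : ContinuousOn f (Metric.sphere 0 |1|)) (Q : ℂ[X]) :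
      CircleIntegrable (fun w => (w ^ 2)⁻¹ * (f w * Q.eval w)) 0 1 := by
    refine ContinuousOn.circleIntegrable' ?_
    refine ContinuousOn.mul (ContinuousOn.inv₀ (by fun_prop) ?_) (hf.mul Q.continuous.continuousOn)
    intro x hx
    have : x ≠ 0 := by rintro rfl; simp at hx
    exact pow_ne_zero 2 this
  have i1 := hci (f := fun _ => 1) continuousOn_const (p v₁ v₂ v₃ * p' v₁ v₂ v₃)
  have i2 := hci (f := fun _ => 1) continuousOn_const (p u₁ u₂ u₃ * p' u₁ u₂ u₃)
  have i3 := hci hgc (p v₁ v₂ v₃ * p' u₁ u₂ u₃)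
  -- With `H = p v` and `K = p u`, the averaged function is `|H|² + |K|² - 2 Re(g H conj K)`, which
  -- is at least `(|H| - |K|)²` because `|g| ≤ 1`.
  have key := Complex.reCLM.circleAverage_comp_comm ((i1.add i2).sub (i3.add i3))
  rw [Real.circleAverage_sub (i1.add i2) (i3.add i3), Real.circleAverage_add i1 i2,
    Real.circleAverage_add i3 i3, h1, h2, h3] at key
  have hpos := Real.circleAverage_nonneg_of_nonneg (c := 0) (R := 1) (f := Complex.reCLM ∘
    (((fun w => (w ^ 2)⁻¹ * (1 * (p v₁ v₂ v₃ * p' v₁ v₂ v₃).eval w)) +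
      fun w => (w ^ 2)⁻¹ * (1 * (p u₁ u₂ u₃ * p' u₁ u₂ u₃).eval w)) -
      ((fun w => (w ^ 2)⁻¹ * (g w * (p v₁ v₂ v₃ * p' u₁ u₂ u₃).eval w)) +
      fun w => (w ^ 2)⁻¹ * (g w * (p v₁ v₂ v₃ * p' u₁ u₂ u₃).eval w)))) ?_
  · rw [key] at hpos
    have e : ∀ z : ℂ, z * starRingEnd ℂ z = ((‖z‖ ^ 2 : ℝ) : ℂ) := fun z => by
      rw [Complex.mul_conj, Complex.normSq_eq_norm_sq]
    -- The mixed average is `⟨Tv, u⟩ = ‖u‖²` since `u = Tv`; positivity then reads `‖v‖² + ‖u‖² -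
    -- 2‖u‖² ≥ 0`.
    have e3 : a₂ * (v₃ * starRingEnd ℂ u₁) + a₁ * (v₂ * starRingEnd ℂ u₁ + v₃ * starRingEnd ℂ u₂) +
        a₀ * (v₁ * starRingEnd ℂ u₁ + v₂ * starRingEnd ℂ u₂ + v₃ * starRingEnd ℂ u₃) =
        u₁ * starRingEnd ℂ u₁ + u₂ * starRingEnd ℂ u₂ + u₃ * starRingEnd ℂ u₃ := by
      conv_rhs => lhs; lhs; lhs; rw [hu₁]
      conv_rhs => lhs; rhs; lhs; rw [hu₂]
      conv_rhs => rhs; lhs; rw [hu₃]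
      ring
    rw [e3] at hpos
    simp only [e, Complex.reCLM_apply] at hpos
    norm_cast at hpos
    simp at hpos
    exact_mod_cast hpos
  · intro w hw
    have hgw : ‖g w‖ ≤ 1 := hb w (by simpa using Metric.sphere_subset_closedBall hw)
    have r1 (x y z x' y' z' c : ℂ) : (w ^ 2)⁻¹ * (c * (p x y z * p' x' y' z').eval w) =
        c * (p x y z).eval w * starRingEnd ℂ ((p x' y' z').eval w) := by
      rw [← hrefl hw, eval_mul]; ring
    simp only [Function.comp, Pi.add_apply, Pi.sub_apply, r1]
    generalize (p v₁ v₂ v₃).eval w = H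
    generalize (p u₁ u₂ u₃).eval w = K
    have b : (g w * H * starRingEnd ℂ K).re ≤ ‖H‖ * ‖K‖ := by
      refine (Complex.re_le_norm _).trans ?_
      rw [norm_mul, norm_mul, RCLike.norm_conj]
      nlinarith [mul_nonneg (norm_nonneg H) (norm_nonneg K)]
    have e : ∀ z : ℂ, (1 * z * starRingEnd ℂ z).re = ‖z‖ ^ 2 := fun z => by
      rw [one_mul, Complex.mul_conj, Complex.normSq_eq_norm_sq, Complex.ofReal_re]
    simp only [Complex.reCLM_apply, Complex.add_re, Complex.sub_re, e]
    nlinarith [sq_nonneg (‖H‖ - ‖K‖)]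

/-! ### Functions of the nilpotent matrix -/

theorem minpoly_eq_X_pow_three {n : ℕ} {N : Matrix (Fin n) (Fin n) ℂ} (h3 : N ^ 3 = 0)
    (h2 : N ^ 2 ≠ 0) : minpoly ℂ N = Polynomial.X ^ 3 := by
  have hd : minpoly ℂ N ∣ Polynomial.X ^ 3 := minpoly.dvd _ _ (by simp [h3])
  obtain ⟨k, hk, hk'⟩ := (dvd_prime_pow Polynomial.prime_X 3).1 hd
  have hm : minpoly ℂ N = Polynomial.X ^ k :=
    Polynomial.eq_of_monic_of_associated (minpoly.monic (Matrix.isIntegral N))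
      (Polynomial.monic_X_pow k) hk'
  have h0 := minpoly.aeval ℂ N
  rw [hm, map_pow, Polynomial.aeval_X] at h0
  have : ¬ k ≤ 2 := fun h => h2 (pow_eq_zero_of_le h h0)
  rw [hm, show k = 3 by omega]

/-- A function of a matrix with nilpotency index three is given by its Taylor polynomial. -/
theorem matFun_of_pow_three_eq_zero {n : ℕ} {N : Matrix (Fin n) (Fin n) ℂ} (h3 : N ^ 3 = 0)
    (h2 : N ^ 2 ≠ 0) (f : ℂ → ℂ) :
    matFun f N = f 0 • (1 : Matrix (Fin n) (Fin n) ℂ) + deriv f 0 • N +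
      (iteratedDeriv 2 f 0 / 2) • N ^ 2 := by
  rw [matFun_eq_aeval f N (Polynomial.C (f 0) + Polynomial.C (deriv f 0) * Polynomial.X +
    Polynomial.C (iteratedDeriv 2 f 0 / 2) * Polynomial.X ^ 2)]
  · simp [Algebra.algebraMap_eq_smul_one]
  · intro z k hk
    rw [minpoly_eq_X_pow_three h3 h2] at hk
    rw [← Polynomial.count_roots, Polynomial.roots_X_pow] at hk
    obtain rfl : z = 0 := by
      by_contra hz
      simp [hz] at hk
    simp at hk
    interval_cases k
    · simp
    · simp [iteratedDeriv_one]
    · simp; ring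

theorem exA_pow_two (t : ℝ) : exA t ^ 2 = !![0, 0, 1 - (t : ℂ); 0, 0, 0; 0, 0, 0] := by
  ext i j
  fin_cases i <;> fin_cases j <;> simp [exA, pow_two, Matrix.mul_apply, Fin.sum_univ_three]

theorem exA_pow_three (t : ℝ) : exA t ^ 3 = 0 := by
  rw [pow_succ, exA_pow_two]
  ext i j
  fin_cases i <;> fin_cases j <;> simp [exA, Matrix.mul_apply, Fin.sum_univ_three]

theorem exA_pow_two_ne_zero {t : ℝ} (ht : t ≠ 1) : exA t ^ 2 ≠ 0 := by
  intro h
  have := congrFun (congrFun h 0) 2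
  rw [exA_pow_two] at this
  simp [sub_eq_zero] at this
  exact ht (by exact_mod_cast this.symm)

theorem exR_pos (t : ℝ) : 0 < exR t := by
  unfold exR; positivity

theorem exR_sq (t : ℝ) : exR t ^ 2 = (1 + (1 - t) ^ 2) / 4 := by
  rw [exR, div_pow, Real.sq_sqrt (by positivity)]; norm_num

theorem deriv_comp_exPhi (t : ℝ) (B : ℂ → ℂ) :
    deriv (B ∘ exPhi t) 0 = (1 / (exR t : ℂ)) * deriv B 0 := by
  have := deriv_comp_mul_left (1 / (exR t : ℂ)) B 0
  rwa [mul_zero, smul_eq_mul] at this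

theorem iteratedDeriv_two_comp_mul_left (c : ℂ) (B : ℂ → ℂ) :
    iteratedDeriv 2 (fun z => B (c * z)) 0 = c ^ 2 * iteratedDeriv 2 B 0 := by
  have h : deriv (fun z => B (c * z)) = fun z => c • deriv B (c * z) := by
    ext z; exact deriv_comp_mul_left c B z
  rw [iteratedDeriv_succ', iteratedDeriv_one, h, iteratedDeriv_succ', iteratedDeriv_one]
  have := deriv_comp_mul_left c (deriv B) 0
  rw [deriv_fun_const_smul_field, this]
  simp; ring

theorem iteratedDeriv_two_comp_exPhi (t : ℝ) (B : ℂ → ℂ) :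
    iteratedDeriv 2 (B ∘ exPhi t) 0 = (1 / (exR t : ℂ)) ^ 2 * iteratedDeriv 2 B 0 :=
  iteratedDeriv_two_comp_mul_left _ B

theorem matFun_exPhi {t : ℝ} (ht : t ≠ 1) :
    matFun (exPhi t) (exA t) = (1 / (exR t : ℂ)) • exA t := by
  rw [matFun_of_pow_three_eq_zero (exA_pow_three t) (exA_pow_two_ne_zero ht)]
  have h := deriv_comp_exPhi t id
  have h' := iteratedDeriv_two_comp_exPhi t id
  rw [Function.id_comp] at h h'
  rw [h, h']
  simp [exPhi, iteratedDeriv_succ']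

/-- Both `A` and `A/r` have nilpotency index three, so only the scaling of the first two derivatives
is compared. That scaling rule holds for arbitrary `B`, since `deriv` has a default value. -/
theorem matFun_matFun_exPhi {t : ℝ} (ht : t ≠ 1) (B : ℂ → ℂ) :
    matFun B (matFun (exPhi t) (exA t)) = matFun (B ∘ exPhi t) (exA t) := by
  have hr : (exR t : ℂ) ≠ 0 := by exact_mod_cast (exR_pos t).ne'
  rw [matFun_exPhi ht,
    matFun_of_pow_three_eq_zero (exA_pow_three t) (exA_pow_two_ne_zero ht),
    matFun_of_pow_three_eq_zero (by rw [smul_pow, exA_pow_three, smul_zero])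
      (by rw [smul_pow]; exact smul_ne_zero (by simp [hr]) (exA_pow_two_ne_zero ht)),
    deriv_comp_exPhi, iteratedDeriv_two_comp_exPhi]
  simp only [smul_pow, smul_smul, Function.comp, exPhi, mul_zero]
  congr 2 <;> ring_nf

/-! ### Operator norms -/

theorem norm_sq_taylor_exA_mulVec (t : ℝ) (c₀ c₁ c₂ : ℂ) (x : Fin 3 → ℂ) :
    ‖WithLp.toLp 2 ((c₀ • (1 : Matrix (Fin 3) (Fin 3) ℂ) + c₁ • exA t +
        c₂ • exA t ^ 2).mulVec x)‖ ^ 2 =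
      ‖c₀ * x 0 + c₁ * x 1 + c₂ * (1 - t) * x 2‖ ^ 2 +
      ‖c₀ * x 1 + c₁ * (1 - t) * x 2‖ ^ 2 + ‖c₀ * x 2‖ ^ 2 := by
  rw [EuclideanSpace.norm_sq_eq, Fin.sum_univ_three, exA_pow_two]
  simp [Matrix.mulVec, dotProduct, Fin.sum_univ_three, exA]

theorem matrix_norm_mulVec_le {n : ℕ} (M : Matrix (Fin n) (Fin n) ℂ) (x : Fin n → ℂ) :
    ‖WithLp.toLp 2 (M.mulVec x)‖ ≤ ‖M‖ * ‖WithLp.toLp 2 x‖ :=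
  M.l2_opNorm_mulVec (WithLp.toLp 2 x)

theorem matrix_norm_le_of_forall {n : ℕ} (M : Matrix (Fin n) (Fin n) ℂ) {C : ℝ} (hC : 0 ≤ C)
    (h : ∀ x : Fin n → ℂ, ‖WithLp.toLp 2 (M.mulVec x)‖ ≤ C * ‖WithLp.toLp 2 x‖) : ‖M‖ ≤ C := by
  rw [Matrix.l2_opNorm_def]
  exact ContinuousLinearMap.opNorm_le_bound _ hC fun x => h x.ofLp

/-- Compactness of the unit sphere yields a norming vector; the equality cases rest on it. -/
theorem exists_norm_mulVec_eq {n : ℕ} [NeZero n] (M : Matrix (Fin n) (Fin n) ℂ) :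
    ∃ x : Fin n → ℂ, ‖WithLp.toLp 2 x‖ = 1 ∧ ‖WithLp.toLp 2 (M.mulVec x)‖ = ‖M‖ := by
  have hne : (Metric.sphere (0 : EuclideanSpace ℂ (Fin n)) 1).Nonempty :=
    ⟨EuclideanSpace.single 0 1, by simp⟩
  have hcont : Continuous fun x : EuclideanSpace ℂ (Fin n) =>
      ‖WithLp.toLp 2 (M.mulVec x.ofLp)‖ := by
    exact ((Matrix.toEuclideanLin.trans LinearMap.toContinuousLinearMap M).continuous).norm
  obtain ⟨x, hx, hmax⟩ := (isCompact_sphere _ _).exists_isMaxOn hne hcont.continuousOn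
  have hx1 : ‖x‖ = 1 := by simpa using hx
  refine ⟨x.ofLp, hx1, le_antisymm ?_ ?_⟩
  · simpa [hx1] using matrix_norm_mulVec_le M x.ofLp
  · refine matrix_norm_le_of_forall M (norm_nonneg _) fun y => ?_
    by_cases hy : y = 0
    · simp [hy]
    have hy' : ‖WithLp.toLp 2 y‖ ≠ 0 := by simpa using hy
    have h := hmax (a := (‖WithLp.toLp 2 y‖⁻¹ : ℂ) • WithLp.toLp 2 y)
      (by simp [norm_smul, hy'])
    simp only [Set.mem_ofPred_eq, WithLp.ofLp_smul, Matrix.mulVec_smul, WithLp.toLp_smul,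
      norm_smul, norm_inv, Complex.norm_real, norm_norm] at h
    rwa [inv_mul_le_iff₀ (by positivity), mul_comm] at h

/-! ### The numerical range and its admissible functions -/

theorem numRange_exA (t : ℝ) : numRange (exA t) = Metric.closedBall 0 (exR t) := by
  have hd : 0 < √(1 + (1 - t) ^ 2) := by positivity
  have hd2 : √(1 + (1 - t) ^ 2) ^ 2 = 1 + (1 - t) ^ 2 := Real.sq_sqrt (by positivity)
  set d := √(1 + (1 - t) ^ 2) with hdef
  have hr : exR t = d / 2 := rfl
  have hform (q : Fin 3 → ℂ) : star q ⬝ᵥ (exA t).mulVec q =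
      starRingEnd ℂ (q 0) * q 1 + starRingEnd ℂ (q 1) * ((1 - t) * q 2) := by
    simp [exA, Matrix.mulVec, dotProduct, Fin.sum_univ_three]
  ext w
  rw [mem_closedBall_zero_iff, hr]
  constructor
  · rintro ⟨q, hq, rfl⟩
    rw [hform]
    have hq2 : ‖q 0‖ ^ 2 + ‖q 1‖ ^ 2 + ‖q 2‖ ^ 2 = 1 := by
      have := EuclideanSpace.norm_sq_eq q
      rw [hq, Fin.sum_univ_three] at this
      linarith
    refine (norm_add_le _ _).trans ?_
    have hs : ‖(1 - t : ℂ)‖ = |1 - t| := by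
      rw [← Complex.ofReal_one, ← Complex.ofReal_sub, Complex.norm_real, Real.norm_eq_abs]
    simp only [norm_mul, RCLike.norm_conj, hs]
    have hs2 : |1 - t| ^ 2 = (1 - t) ^ 2 := sq_abs _
    rw [← hs2] at hd2
    set a := ‖q 0‖
    set b := ‖q 1‖
    set c := ‖q 2‖
    -- Cauchy–Schwarz for `(1, |1-t|)` and `(a, c)`.
    have hcs : a + |1 - t| * c ≤ d * √(a ^ 2 + c ^ 2) := by
      refine abs_le_of_sq_le_sq' ?_ (by positivity) |>.2
      rw [mul_pow, hd2, Real.sq_sqrt (by positivity)]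
      nlinarith [sq_nonneg (c - |1 - t| * a)]
    have he : √(a ^ 2 + c ^ 2) ^ 2 = a ^ 2 + c ^ 2 := Real.sq_sqrt (by positivity)
    -- Here `b² + e² = 1`, so `be ≤ 1/2`.
    set e := √(a ^ 2 + c ^ 2)
    have hb : 0 ≤ b := norm_nonneg _
    have hbe : b * e ≤ 1 / 2 := by nlinarith [sq_nonneg (b - e)]
    calc a * b + b * (|1 - t| * c) = b * (a + |1 - t| * c) := by ring
      _ ≤ b * (d * e) := by gcongr
      _ = d * (b * e) := by ring
      _ ≤ d * (1 / 2) := by gcongr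
      _ = d / 2 := by ring
  · intro hw
    obtain ⟨ψ, hψ⟩ : ∃ ψ : ℂ, ‖ψ‖ = 1 ∧ w = ‖w‖ * ψ :=
      ⟨Complex.exp (w.arg * Complex.I), Complex.norm_exp_ofReal_mul_I _,
        (Complex.norm_mul_exp_arg_mul_I w).symm⟩
    set β := Real.arcsin (2 * ‖w‖ / d) / 2
    have hsin : 2 * Real.sin β * Real.cos β = 2 * ‖w‖ / d := by
      rw [← Real.sin_two_mul, show 2 * β = Real.arcsin (2 * ‖w‖ / d) by ring, Real.sin_arcsin]
      · have : 0 ≤ 2 * ‖w‖ / d := by positivity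
        linarith
      · rw [div_le_one hd]; linarith
    have hψ1 : ψ * starRingEnd ℂ ψ = 1 := by
      rw [Complex.mul_conj, Complex.normSq_eq_norm_sq, hψ.1]; simp
    have hdC : (d : ℂ) ≠ 0 := by exact_mod_cast hd.ne'
    -- This `q` makes both inequalities above tight up to the angle: its form value is `d sin β cos
    -- β · ψ = (d/2) sin(2β) ψ`, and `β` is chosen so that this is `w`.
    refine ⟨WithLp.toLp 2 ![((Real.cos β / d : ℝ) : ℂ), ((Real.sin β : ℝ) : ℂ) * ψ,
      ((Real.cos β * (1 - t) / d : ℝ) : ℂ) * ψ ^ 2], ?_, ?_⟩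
    · rw [← sq_eq_sq₀ (norm_nonneg _) zero_le_one, EuclideanSpace.norm_sq_eq, Fin.sum_univ_three]
      simp only [Matrix.cons_val_zero, Matrix.cons_val_one, Matrix.cons_val_two, Matrix.head_cons,
        Matrix.tail_cons, norm_mul, norm_pow, hψ.1, Complex.norm_real,
        Real.norm_eq_abs, sq_abs, one_pow, mul_one]
      rw [div_pow, div_pow, mul_pow]
      field_simp
      rw [hd2]
      linear_combination (1 + (1 - t) ^ 2) * Real.sin_sq_add_cos_sq β
    · rw [hform]
      simp only [Matrix.cons_val_zero, Matrix.cons_val_one, Matrix.cons_val, map_mul,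
        Complex.conj_ofReal]
      have h1 : (‖w‖ : ℂ) = d * Real.sin β * Real.cos β := by
        have : ‖w‖ = d * Real.sin β * Real.cos β := by
          field_simp at hsin
          linarith
        exact_mod_cast this
      have hd2C : (d : ℂ) ^ 2 = 1 + (1 - t) ^ 2 := by exact_mod_cast hd2
      rw [hψ.2, h1]
      push_cast
      field_simp
      linear_combination (ψ * Complex.sin β * Complex.cos β) * hd2C -
        (1 - t) ^ 2 * ψ * Complex.sin β * Complex.cos β * hψ1

theorem interior_numRange_exA (t : ℝ) : interior (numRange (exA t)) = Metric.ball 0 (exR t) := by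
  rw [numRange_exA, interior_closedBall _ (exR_pos t).ne']

theorem norm_exPhi (t : ℝ) (z : ℂ) : ‖exPhi t z‖ = ‖z‖ / exR t := by
  rw [exPhi, norm_mul, norm_div, norm_one, Complex.norm_real, Real.norm_eq_abs,
    abs_of_pos (exR_pos t)]
  ring

theorem isConformalOntoDisk_exPhi (t : ℝ) : IsConformalOntoDisk (exPhi t) (numRange (exA t)) := by
  have hr := exR_pos t
  have hrC : (exR t : ℂ) ≠ 0 := by exact_mod_cast hr.ne'
  refine ⟨by unfold exPhi; fun_prop, by unfold exPhi; fun_prop, ?_⟩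
  rw [interior_numRange_exA]
  refine ⟨fun z hz => ?_, fun z _ w _ h => ?_, fun w hw => ⟨exR t * w, ?_, ?_⟩⟩
  · rw [mem_ball_zero_iff] at hz ⊢
    rwa [norm_exPhi, div_lt_one hr]
  · exact mul_left_cancel₀ (by simpa using hrC) h
  · rw [mem_ball_zero_iff] at hw ⊢
    rw [norm_mul, Complex.norm_real, Real.norm_eq_abs, abs_of_pos hr]
    nlinarith
  · simp [exPhi, hrC]

/-- The Taylor coefficients of an admissible function, rescaled to the unit disk, form a
contractive Toeplitz matrix. -/
theorem admissible_toeplitz {t : ℝ} {f : ℂ → ℂ} (hf : f ∈ admissible (exA t)) (x₀ x₁ x₂ : ℂ) :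
    ‖f 0 * x₀ + deriv f 0 * x₁ + iteratedDeriv 2 f 0 / 2 * (1 - t) * x₂‖ ^ 2 +
        (1 / exR t) ^ 2 * ‖f 0 * x₁ + deriv f 0 * (1 - t) * x₂‖ ^ 2 +
        ((1 - t) / exR t ^ 2) ^ 2 * ‖f 0 * x₂‖ ^ 2 ≤
      ‖x₀‖ ^ 2 + (1 / exR t) ^ 2 * ‖x₁‖ ^ 2 + ((1 - t) / exR t ^ 2) ^ 2 * ‖x₂‖ ^ 2 := by
  have hr := exR_pos t
  have hrC : (exR t : ℂ) ≠ 0 := by exact_mod_cast hr.ne'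
  obtain ⟨hc, hd, hb⟩ := hf
  rw [interior_numRange_exA] at hd
  rw [numRange_exA] at hc hb
  set r := exR t
  have hmul {z : ℂ} : ‖(r : ℂ) * z‖ = r * ‖z‖ := by
    rw [norm_mul, Complex.norm_real, Real.norm_eq_abs, abs_of_pos hr]
  have hg : DiffContOnCl ℂ (fun z => f (r * z)) (Metric.ball 0 1) := by
    refine ⟨hd.comp (by fun_prop) fun z hz => ?_, ?_⟩
    · rw [mem_ball_zero_iff] at hz ⊢
      rw [hmul]; nlinarith
    · rw [closure_ball _ one_ne_zero]
      refine hc.comp (by fun_prop) fun z hz => ?_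
      rw [mem_closedBall_zero_iff] at hz ⊢
      rw [hmul]; nlinarith
  -- The vector is `Dx` with `D = diag(1, 1/r, (1-t)/r²)`, so the Toeplitz matrix sends it to `D
  -- f(A) x`.
  have h := taylor_toeplitz_contraction hg (fun z hz => hb _ ?_) x₀ (1 / r * x₁)
    ((1 - t) / r ^ 2 * x₂)
  · have e1 := deriv_comp_mul_left (r : ℂ) f 0
    rw [iteratedDeriv_two_comp_mul_left, e1] at h
    simp only [mul_zero, smul_eq_mul] at h
    have n1 : ‖(1 / r : ℂ)‖ ^ 2 = (1 / r) ^ 2 := by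
      rw [norm_div, norm_one, Complex.norm_real, Real.norm_eq_abs, abs_of_pos hr]
    have n2 : ‖((1 - t) / r ^ 2 : ℂ)‖ ^ 2 = ((1 - t) / r ^ 2) ^ 2 := by
      have : ((1 - t) / r ^ 2 : ℂ) = (((1 - t) / r ^ 2 : ℝ) : ℂ) := by push_cast; rfl
      rw [this, Complex.norm_real, Real.norm_eq_abs, sq_abs]
    rw [show f 0 * x₀ + r * deriv f 0 * (1 / r * x₁) +
        r ^ 2 * iteratedDeriv 2 f 0 / 2 * ((1 - t) / r ^ 2 * x₂) =
        f 0 * x₀ + deriv f 0 * x₁ + iteratedDeriv 2 f 0 / 2 * (1 - t) * x₂ by field_simp,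
      show f 0 * (1 / r * x₁) + r * deriv f 0 * ((1 - t) / r ^ 2 * x₂) =
        (1 / r) * (f 0 * x₁ + deriv f 0 * (1 - t) * x₂) by field_simp,
      show f 0 * ((1 - t) / r ^ 2 * x₂) = ((1 - t) / r ^ 2) * (f 0 * x₂) by ring] at h
    simp only [norm_mul _ _, mul_pow, n1, n2] at h ⊢
    exact h
  · rw [mem_closedBall_zero_iff] at hz ⊢
    rw [hmul]; nlinarith

/-! ### Blaschke products -/

theorem one_sub_conj_mul_ne_zero {a z : ℂ} (ha : ‖a‖ < 1) (hz : ‖z‖ ≤ 1) :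
    1 - starRingEnd ℂ a * z ≠ 0 := by
  intro h
  have h1 : ‖starRingEnd ℂ a * z‖ = 1 := by rw [← sub_eq_zero.1 h, norm_one]
  rw [norm_mul, RCLike.norm_conj] at h1
  nlinarith [norm_nonneg a, norm_nonneg z]

/-- From `|1 - āz|² - |z - a|² = (1 - |a|²)(1 - |z|²)`. -/
theorem norm_blaschke_factor_le {a z : ℂ} (ha : ‖a‖ < 1) (hz : ‖z‖ ≤ 1) :
    ‖(z - a) / (1 - starRingEnd ℂ a * z)‖ ≤ 1 := by
  rw [norm_div, div_le_one (norm_pos_iff.2 (one_sub_conj_mul_ne_zero ha hz)),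
    ← sq_le_sq₀ (norm_nonneg _) (norm_nonneg _), ← Complex.normSq_eq_norm_sq,
    ← Complex.normSq_eq_norm_sq]
  have ha' : Complex.normSq a ≤ 1 := by
    rw [Complex.normSq_eq_norm_sq]; nlinarith [norm_nonneg a]
  have hz' : Complex.normSq z ≤ 1 := by
    rw [Complex.normSq_eq_norm_sq]; nlinarith [norm_nonneg z]
  rw [Complex.normSq_apply] at *
  simp only [Complex.normSq_apply, Complex.sub_re, Complex.sub_im, Complex.mul_re, Complex.mul_im,
    Complex.conj_re, Complex.conj_im, Complex.one_re, Complex.one_im] at *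
  nlinarith [mul_nonneg (sub_nonneg.2 ha') (sub_nonneg.2 hz')]

theorem IsBlaschke.differentiableAt {m : ℕ} {B : ℂ → ℂ} (hB : IsBlaschke m B) {z : ℂ}
    (hz : ‖z‖ ≤ 1) : DifferentiableAt ℂ B z := by
  obtain ⟨γ, α, hα, rfl⟩ := hB
  refine (differentiableAt_const _).mul ?_
  refine DifferentiableAt.fun_finsetProd fun j _ => ?_
  exact DifferentiableAt.div (by fun_prop) (by fun_prop) (one_sub_conj_mul_ne_zero (hα j) hz)

theorem IsBlaschke.norm_le_one {m : ℕ} {B : ℂ → ℂ} (hB : IsBlaschke m B) {z : ℂ}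
    (hz : ‖z‖ ≤ 1) : ‖B z‖ ≤ 1 := by
  obtain ⟨γ, α, hα, rfl⟩ := hB
  rw [norm_mul, mul_comm Complex.I, Complex.norm_exp_ofReal_mul_I, one_mul, norm_prod]
  exact Finset.prod_le_one (fun _ _ => norm_nonneg _) fun j _ => norm_blaschke_factor_le (hα j) hz

theorem IsBlaschke.contDiffAt {m : ℕ} {B : ℂ → ℂ} (hB : IsBlaschke m B) (n : ℕ) :
    ContDiffAt ℂ n B 0 := by
  have : DifferentiableOn ℂ B (Metric.ball 0 1) := fun z hz =>
    (hB.differentiableAt (mem_ball_zero_iff.1 hz).le).differentiableWithinAt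
  exact (this.contDiffOn Metric.isOpen_ball).contDiffAt (Metric.isOpen_ball.mem_nhds (by simp))

/-- A zero at the origin must come from some `α j = 0`, whose factor is `z` itself. -/
theorem IsBlaschke.exists_eq_mul_of_eq_zero {m : ℕ} {B : ℂ → ℂ} (hB : IsBlaschke m B)
    (h0 : B 0 = 0) : ∃ (m' : ℕ) (C : ℂ → ℂ), m = m' + 1 ∧ IsBlaschke m' C ∧
      B = fun z => z * C z := by
  obtain ⟨γ, α, hα, rfl⟩ := hB
  simp only [mul_eq_zero, Complex.exp_ne_zero, false_or, Finset.prod_eq_zero_iff] at h0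
  obtain ⟨j, -, hj⟩ := h0
  have hj : α j = 0 := by simpa using hj
  obtain _ | m' := m
  · exact j.elim0
  refine ⟨m', _, rfl, ⟨γ, fun i => α (j.succAbove i), fun i => hα _, rfl⟩, ?_⟩
  ext z
  rw [Fin.prod_univ_succAbove _ j, hj]
  simp
  ring

/-- `|B(0)|` is the product of the `|α j|`, which is below one as soon as there is a factor. -/
theorem IsBlaschke.degree_eq_zero {m : ℕ} {B : ℂ → ℂ} (hB : IsBlaschke m B) (h : ‖B 0‖ = 1) :
    m = 0 := by
  obtain ⟨γ, α, hα, rfl⟩ := hB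
  rw [norm_mul, mul_comm Complex.I, Complex.norm_exp_ofReal_mul_I, one_mul, norm_prod] at h
  obtain _ | m := m
  · rfl
  simp only [Fin.prod_univ_succ, zero_sub, mul_zero, sub_zero, div_one, norm_neg] at h
  have h1 : ∏ i : Fin m, ‖α i.succ‖ ≤ 1 :=
    Finset.prod_le_one (fun _ _ => norm_nonneg _) fun j _ => (hα _).le
  have := hα 0
  have h2 : (0 : ℝ) ≤ ∏ i : Fin m, ‖α i.succ‖ := Finset.prod_nonneg fun _ _ => norm_nonneg _
  nlinarith [norm_nonneg (α 0)]

theorem IsBlaschke.exists_eq_const {B : ℂ → ℂ} (hB : IsBlaschke 0 B) :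
    ∃ c : ℂ, ‖c‖ = 1 ∧ B = fun _ => c := by
  obtain ⟨γ, α, hα, rfl⟩ := hB
  exact ⟨Complex.exp (Complex.I * γ),
    by rw [mul_comm Complex.I, Complex.norm_exp_ofReal_mul_I], by simp⟩

theorem isBlaschke_pow (m : ℕ) : IsBlaschke m fun z => z ^ m :=
  ⟨0, fun _ => 0, by simp, by simp⟩

theorem deriv_id_mul_zero {C : ℂ → ℂ} (hC : DifferentiableAt ℂ C 0) :
    deriv (fun z => z * C z) 0 = C 0 := by
  rw [deriv_fun_mul differentiableAt_fun_id hC]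
  simp

theorem iteratedDeriv_two_id_mul_zero {C : ℂ → ℂ} (hC : ContDiffAt ℂ 2 C 0) :
    iteratedDeriv 2 (fun z => z * C z) 0 = 2 * deriv C 0 := by
  have e : (fun z => z * C z) = (fun z => z) * C := rfl
  rw [e, iteratedDeriv_mul contDiffAt_fun_id (by exact_mod_cast hC)]
  simp [Finset.sum_range_succ, iteratedDeriv_succ']

/-- A Blaschke product vanishing at the origin with unimodular derivative there is a rotation. -/
theorem IsBlaschke.eq_const_mul_id {m : ℕ} {B : ℂ → ℂ} (hB : IsBlaschke m B) (h0 : B 0 = 0)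
    (h1 : ‖deriv B 0‖ = 1) : m = 1 ∧ ∃ c : ℂ, ‖c‖ = 1 ∧ ∀ z, B z = c * z := by
  obtain ⟨m', C, rfl, hC, rfl⟩ := hB.exists_eq_mul_of_eq_zero h0
  rw [deriv_id_mul_zero (hC.differentiableAt (by simp))] at h1
  obtain rfl := hC.degree_eq_zero h1
  obtain ⟨c, hc, rfl⟩ := hC.exists_eq_const
  exact ⟨rfl, c, hc, fun z => mul_comm _ _⟩

/-- Writing `B = zC` shifts Taylor coefficients down by one, which reduces to
`IsBlaschke.eq_const_mul_id` for `C`. -/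
theorem IsBlaschke.eq_const_mul_sq {m : ℕ} {B : ℂ → ℂ} (hB : IsBlaschke m B) (h0 : B 0 = 0)
    (h1 : deriv B 0 = 0) (h2 : ‖iteratedDeriv 2 B 0 / 2‖ = 1) :
    m = 2 ∧ ∃ c : ℂ, ‖c‖ = 1 ∧ ∀ z, B z = c * z ^ 2 := by
  obtain ⟨m', C, rfl, hC, rfl⟩ := hB.exists_eq_mul_of_eq_zero h0
  rw [deriv_id_mul_zero (hC.differentiableAt (by simp))] at h1
  rw [iteratedDeriv_two_id_mul_zero (by exact_mod_cast hC.contDiffAt 2),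
    mul_div_cancel_left₀ _ two_ne_zero] at h2
  obtain ⟨rfl, c, hc, h⟩ := hC.eq_const_mul_id h1 h2
  exact ⟨rfl, c, hc, fun z => by simp only [h]; ring⟩

/-! ### Comparison of `1`, `1/r` and `(1-t)/r²` -/

theorem sqrt_three_sub_one_lt_one : √3 - 1 < 1 := by
  nlinarith [Real.sq_sqrt (show (0 : ℝ) ≤ 3 by norm_num), Real.sqrt_nonneg 3]

theorem ne_one_of_mem_Icc {t : ℝ} (ht : t ∈ Set.Icc (0 : ℝ) (√3 - 1)) : t ≠ 1 :=
  (ht.2.trans_lt sqrt_three_sub_one_lt_one).ne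

theorem one_lt_one_div_exR {t : ℝ} (ht : t ∈ Set.Icc (0 : ℝ) (√3 - 1)) : 1 < 1 / exR t := by
  have := ht.2.trans_lt sqrt_three_sub_one_lt_one
  rw [lt_div_iff₀ (exR_pos t), one_mul, ← sq_lt_one_iff₀ (exR_pos t).le, exR_sq]
  nlinarith [ht.1]

/-- With `s = 1-t` this is `s² - 4s + 1 ≤ 0`, whose smaller root `s = 2 - √3` is the endpoint `t =
√3 - 1`. -/
theorem one_le_one_sub_div_exR_sq {t : ℝ} (ht : t ∈ Set.Icc (0 : ℝ) (√3 - 1)) :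
    1 ≤ (1 - t) / exR t ^ 2 := by
  rw [one_le_div (pow_pos (exR_pos t) 2), exR_sq]
  nlinarith [Real.sq_sqrt (show (0 : ℝ) ≤ 3 by norm_num), ht.1, ht.2, Real.sqrt_nonneg 3]

/-- Both sides say `r < 1-t`, that is `1 + (1-t)² < 4(1-t)²`. -/
theorem one_div_exR_lt_iff {t : ℝ} (ht : t < 1) :
    1 / exR t < (1 - t) / exR t ^ 2 ↔ t < 1 - 1 / √3 := by
  have hr := exR_pos t
  have h3 : (1 / √3) ^ 2 = 1 / 3 := by rw [div_pow, Real.sq_sqrt (by norm_num)]; norm_num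
  rw [div_lt_div_iff₀ hr (by positivity), one_mul, pow_two,
    mul_lt_mul_iff_of_pos_right hr, ← sq_lt_sq₀ hr.le (by linarith), exR_sq, lt_sub_comm,
    ← sq_lt_sq₀ (a := 1 / √3) (by positivity) (by linarith), h3]
  constructor <;> intro h <;> linarith

theorem one_sub_div_exR_sq_lt_iff {t : ℝ} (ht : t < 1) :
    (1 - t) / exR t ^ 2 < 1 / exR t ↔ 1 - 1 / √3 < t := by
  have hr := exR_pos t
  have h3 : (1 / √3) ^ 2 = 1 / 3 := by rw [div_pow, Real.sq_sqrt (by norm_num)]; norm_num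
  rw [div_lt_div_iff₀ (by positivity) hr, one_mul, pow_two,
    mul_lt_mul_iff_of_pos_right hr, ← sq_lt_sq₀ (by linarith) hr.le, exR_sq, sub_lt_comm,
    ← sq_lt_sq₀ (b := 1 / √3) (by linarith) (by positivity), h3]
  constructor <;> intro h <;> linarith

/-! ### The norm bound and its equality cases -/

theorem matFun_exA {t : ℝ} (ht : t ≠ 1) (f : ℂ → ℂ) :
    matFun f (exA t) = f 0 • (1 : Matrix (Fin 3) (Fin 3) ℂ) + deriv f 0 • exA t +
      (iteratedDeriv 2 f 0 / 2) • exA t ^ 2 :=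
  matFun_of_pow_three_eq_zero (exA_pow_three t) (exA_pow_two_ne_zero ht) f

/-- In the weighted inequality `‖D f(A) x‖ ≤ ‖Dx‖` all weights lie between `1` and `max(P, Q)`:
bound them below on the left and above on the right. -/
theorem norm_matFun_exA_le {t : ℝ} (ht : t ∈ Set.Icc (0 : ℝ) (√3 - 1)) {f : ℂ → ℂ}
    (hf : f ∈ admissible (exA t)) :
    ‖matFun f (exA t)‖ ≤ max (1 / exR t) ((1 - t) / exR t ^ 2) := by
  have h1 := one_lt_one_div_exR ht
  have h2 := one_le_one_sub_div_exR_sq ht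
  set P := 1 / exR t with hP
  set Q := (1 - t) / exR t ^ 2 with hQ
  have hPK : P ≤ max P Q := le_max_left _ _
  have hQK : Q ≤ max P Q := le_max_right _ _
  set K := max P Q
  refine matrix_norm_le_of_forall _ (by linarith) fun x => ?_
  rw [← sq_le_sq₀ (norm_nonneg _) (by have : 0 ≤ K := by linarith
                                      positivity), matFun_exA (ne_one_of_mem_Icc ht),
    norm_sq_taylor_exA_mulVec, mul_pow, EuclideanSpace.norm_sq_eq, Fin.sum_univ_three]
  have h := admissible_toeplitz hf (x 0) (x 1) (x 2)
  rw [← hP, ← hQ] at h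
  have hP2 : P ^ 2 ≤ K ^ 2 := by gcongr
  have hQ2 : Q ^ 2 ≤ K ^ 2 := by gcongr
  have hP1 : 1 ≤ P ^ 2 := one_le_pow₀ h1.le
  have hQ1 : 1 ≤ Q ^ 2 := one_le_pow₀ h2
  have b0 := mul_le_mul_of_nonneg_right (hP1.trans hP2) (sq_nonneg ‖x 0‖)
  have b1 := mul_le_mul_of_nonneg_right hP2 (sq_nonneg ‖x 1‖)
  have b2 := mul_le_mul_of_nonneg_right hQ2 (sq_nonneg ‖x 2‖)
  have b3 := mul_le_mul_of_nonneg_right hP1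
    (sq_nonneg ‖f 0 * x 1 + deriv f 0 * (1 - t) * x 2‖)
  have b4 := mul_le_mul_of_nonneg_right hQ1 (sq_nonneg ‖f 0 * x 2‖)
  dsimp only
  linarith

theorem taylor_of_norm_matFun_eq_sq {t : ℝ} (ht : t ∈ Set.Icc (0 : ℝ) (√3 - 1))
    (hPQ : 1 / exR t < (1 - t) / exR t ^ 2) {f : ℂ → ℂ} (hf : f ∈ admissible (exA t))
    (hn : ‖matFun f (exA t)‖ = (1 - t) / exR t ^ 2) :
    f 0 = 0 ∧ deriv f 0 = 0 ∧ ‖iteratedDeriv 2 f 0 / 2‖ = (1 / exR t) ^ 2 := by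
  have h1 := one_lt_one_div_exR ht
  obtain ⟨x, hx, hxn⟩ := exists_norm_mulVec_eq (matFun f (exA t))
  have hx2 : ‖x 0‖ ^ 2 + ‖x 1‖ ^ 2 + ‖x 2‖ ^ 2 = 1 := by
    have := EuclideanSpace.norm_sq_eq (WithLp.toLp 2 x)
    rw [hx, Fin.sum_univ_three] at this
    dsimp only at this
    linarith
  have hN := congrArg (· ^ 2) (hxn.trans hn)
  simp only [matFun_exA (ne_one_of_mem_Icc ht), norm_sq_taylor_exA_mulVec] at hN
  have h := admissible_toeplitz hf (x 0) (x 1) (x 2)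
  have hP1 : 1 < (1 / exR t) ^ 2 := one_lt_pow₀ h1 two_ne_zero
  have hPQ2 : (1 / exR t) ^ 2 < ((1 - t) / exR t ^ 2) ^ 2 := by gcongr
  have hts : 0 < 1 - t := by linarith [ht.2.trans_lt sqrt_three_sub_one_lt_one]
  have hQP : (1 - t) / exR t ^ 2 = (1 - t) * (1 / exR t) ^ 2 := by ring
  set P := 1 / exR t
  set Q := (1 - t) / exR t ^ 2
  -- For a norming `x`, `h` and `hN` say that these four nonnegative deficits have sum at most zero,
  -- so each vanishes. Hence `x` lies on the last axis and the lower coefficients of `f` vanish.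
  have d0 := mul_nonneg (sub_nonneg.2 (hP1.trans hPQ2).le) (sq_nonneg ‖x 0‖)
  have d1 := mul_nonneg (sub_nonneg.2 hPQ2.le) (sq_nonneg ‖x 1‖)
  have d2 := mul_nonneg (sub_nonneg.2 hP1.le)
    (sq_nonneg ‖f 0 * x 1 + deriv f 0 * (1 - t) * x 2‖)
  have d3 := mul_nonneg (sub_nonneg.2 (hP1.trans hPQ2).le) (sq_nonneg ‖f 0 * x 2‖)
  have hQx : Q ^ 2 * (‖x 0‖ ^ 2 + ‖x 1‖ ^ 2 + ‖x 2‖ ^ 2) = Q ^ 2 := by rw [hx2, mul_one]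
  have z0 : (Q ^ 2 - 1) * ‖x 0‖ ^ 2 = 0 := by linarith
  have z1 : (Q ^ 2 - P ^ 2) * ‖x 1‖ ^ 2 = 0 := by linarith
  have z2 : (P ^ 2 - 1) * ‖f 0 * x 1 + deriv f 0 * (1 - t) * x 2‖ ^ 2 = 0 := by linarith
  have z3 : (Q ^ 2 - 1) * ‖f 0 * x 2‖ ^ 2 = 0 := by linarith
  have x0 : x 0 = 0 := by simpa [(sub_pos.2 (hP1.trans hPQ2)).ne'] using z0
  have x1 : x 1 = 0 := by simpa [(sub_pos.2 hPQ2).ne'] using z1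
  have hxn2 : ‖x 2‖ = 1 :=
    (pow_eq_one_iff_of_nonneg (norm_nonneg _) two_ne_zero).1 (by simpa [x0, x1] using hx2)
  have x2 : x 2 ≠ 0 := by rintro h; simp [h] at hxn2
  have f0 : f 0 = 0 := by simpa [(sub_pos.2 (hP1.trans hPQ2)).ne', x2] using z3
  have htC : (1 - t : ℂ) ≠ 0 := by exact_mod_cast hts.ne'
  have f1 : deriv f 0 = 0 := by simpa [(sub_pos.2 hP1).ne', x2, x1, htC] using z2
  have hnt : ‖(1 - t : ℂ)‖ = 1 - t := by
    rw [← Complex.ofReal_one, ← Complex.ofReal_sub, Complex.norm_real, Real.norm_eq_abs,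
      abs_of_pos hts]
  refine ⟨f0, f1, ?_⟩
  simp only [f0, f1, x0, x1, zero_mul, mul_zero, zero_add, norm_zero, norm_mul, hnt, hxn2,
    mul_one, ne_eq, OfNat.ofNat_ne_zero, not_false_eq_true, zero_pow, add_zero] at hN
  have hQ0 : 0 ≤ Q := by linarith
  have := (sq_eq_sq₀ (by positivity) hQ0).1 hN
  rw [hQP, mul_comm] at this
  exact mul_left_cancel₀ hts.ne' this

theorem taylor_of_norm_matFun_eq {t : ℝ} (ht : t ∈ Set.Icc (0 : ℝ) (√3 - 1))
    (hPQ : (1 - t) / exR t ^ 2 < 1 / exR t) {f : ℂ → ℂ} (hf : f ∈ admissible (exA t))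
    (hn : ‖matFun f (exA t)‖ = 1 / exR t) :
    f 0 = 0 ∧ ‖deriv f 0‖ = 1 / exR t := by
  have h1 := one_le_one_sub_div_exR_sq ht
  obtain ⟨x, hx, hxn⟩ := exists_norm_mulVec_eq (matFun f (exA t))
  have hx2 : ‖x 0‖ ^ 2 + ‖x 1‖ ^ 2 + ‖x 2‖ ^ 2 = 1 := by
    have := EuclideanSpace.norm_sq_eq (WithLp.toLp 2 x)
    rw [hx, Fin.sum_univ_three] at this
    dsimp only at this
    linarith
  have hN := congrArg (· ^ 2) (hxn.trans hn)
  simp only [matFun_exA (ne_one_of_mem_Icc ht), norm_sq_taylor_exA_mulVec] at hN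
  have h := admissible_toeplitz hf (x 0) (x 1) (x 2)
  have hQ1 : 1 ≤ ((1 - t) / exR t ^ 2) ^ 2 := one_le_pow₀ h1
  have hPQ2 : ((1 - t) / exR t ^ 2) ^ 2 < (1 / exR t) ^ 2 := by gcongr
  set P := 1 / exR t
  set Q := (1 - t) / exR t ^ 2
  have d0 := mul_nonneg (sub_nonneg.2 (hQ1.trans hPQ2.le)) (sq_nonneg ‖x 0‖)
  have d1 := mul_nonneg (sub_nonneg.2 hPQ2.le) (sq_nonneg ‖x 2‖)
  have d2 := mul_nonneg (sub_nonneg.2 (hQ1.trans hPQ2.le))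
    (sq_nonneg ‖f 0 * x 1 + deriv f 0 * (1 - t) * x 2‖)
  have d3 := mul_nonneg (sub_nonneg.2 hQ1) (sq_nonneg ‖f 0 * x 2‖)
  have hQx : P ^ 2 * (‖x 0‖ ^ 2 + ‖x 1‖ ^ 2 + ‖x 2‖ ^ 2) = P ^ 2 := by rw [hx2, mul_one]
  have z0 : (P ^ 2 - 1) * ‖x 0‖ ^ 2 = 0 := by linarith
  have z1 : (P ^ 2 - Q ^ 2) * ‖x 2‖ ^ 2 = 0 := by linarith
  have z2 : (P ^ 2 - 1) * ‖f 0 * x 1 + deriv f 0 * (1 - t) * x 2‖ ^ 2 = 0 := by linarith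
  have x0 : x 0 = 0 := by simpa [(sub_pos.2 (hQ1.trans_lt hPQ2)).ne'] using z0
  have x2 : x 2 = 0 := by simpa [(sub_pos.2 hPQ2).ne'] using z1
  have hxn1 : ‖x 1‖ = 1 :=
    (pow_eq_one_iff_of_nonneg (norm_nonneg _) two_ne_zero).1 (by simpa [x0, x2] using hx2)
  have x1 : x 1 ≠ 0 := by rintro h; simp [h] at hxn1
  -- At `t = √3 - 1` one has `Q = 1`, so `d3` gives nothing there; `f 0 = 0` comes from the middle
  -- row, where `x 2 = 0`.
  have f0 : f 0 = 0 := by simpa [(sub_pos.2 (hQ1.trans_lt hPQ2)).ne', x1, x2] using z2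
  refine ⟨f0, ?_⟩
  simp only [f0, x0, x2, zero_mul, mul_zero, zero_add, norm_zero, norm_mul, hxn1,
    mul_one, ne_eq, OfNat.ofNat_ne_zero, not_false_eq_true, zero_pow, add_zero] at hN
  exact (sq_eq_sq₀ (by positivity) (by linarith)).1 hN

/-! ### The values at `z` and `z²` -/

theorem norm_exA {t : ℝ} (h0 : 0 ≤ t) (h1 : t ≤ 1) : ‖exA t‖ = 1 := by
  have hx (x : Fin 3 → ℂ) : ‖WithLp.toLp 2 ((exA t).mulVec x)‖ ^ 2 =
      ‖x 1‖ ^ 2 + ((1 - t) * ‖x 2‖) ^ 2 := by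
    have := norm_sq_taylor_exA_mulVec t 0 1 0 x
    have hnt : ‖(1 - t : ℂ)‖ = 1 - t := by
      rw [← Complex.ofReal_one, ← Complex.ofReal_sub, Complex.norm_real, Real.norm_eq_abs,
        abs_of_nonneg (by linarith)]
    simpa [hnt] using this
  refine le_antisymm (matrix_norm_le_of_forall _ zero_le_one fun x => ?_) ?_
  · rw [one_mul, ← sq_le_sq₀ (norm_nonneg _) (norm_nonneg _), hx, EuclideanSpace.norm_sq_eq,
      Fin.sum_univ_three]
    have : (1 - t) * ‖x 2‖ ≤ ‖x 2‖ := by nlinarith [norm_nonneg (x 2)]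
    have : ((1 - t) * ‖x 2‖) ^ 2 ≤ ‖x 2‖ ^ 2 :=
      pow_le_pow_left₀ (mul_nonneg (by linarith) (norm_nonneg _)) this 2
    dsimp only
    nlinarith [sq_nonneg ‖x 0‖]
  · have h := matrix_norm_mulVec_le (exA t) (Pi.single 1 1)
    have e : ‖WithLp.toLp 2 ((exA t).mulVec (Pi.single 1 1))‖ = 1 := by
      rw [← sq_eq_sq₀ (norm_nonneg _) zero_le_one, hx]
      simp
    rw [e] at h
    simpa using h

theorem norm_exA_sq {t : ℝ} (h1 : t ≤ 1) : ‖exA t ^ 2‖ = 1 - t := by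
  have hnt : ‖(1 - t : ℂ)‖ = 1 - t := by
    rw [← Complex.ofReal_one, ← Complex.ofReal_sub, Complex.norm_real, Real.norm_eq_abs,
      abs_of_nonneg (by linarith)]
  have hx (x : Fin 3 → ℂ) : ‖WithLp.toLp 2 ((exA t ^ 2).mulVec x)‖ = (1 - t) * ‖x 2‖ := by
    have := norm_sq_taylor_exA_mulVec t 0 0 1 x
    rw [← sq_eq_sq₀ (norm_nonneg _) (mul_nonneg (by linarith) (norm_nonneg _))]
    simpa [hnt] using this
  refine le_antisymm (matrix_norm_le_of_forall _ (by linarith) fun x => ?_) ?_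
  · rw [hx]
    exact mul_le_mul_of_nonneg_left (PiLp.norm_apply_le (WithLp.toLp 2 x) 2) (by linarith)
  · have h := matrix_norm_mulVec_le (exA t ^ 2) (Pi.single 2 1)
    rw [hx] at h
    simpa using h

theorem IsBlaschke.comp_exPhi_mem_admissible {m : ℕ} {B : ℂ → ℂ} (hB : IsBlaschke m B) (t : ℝ) :
    B ∘ exPhi t ∈ admissible (exA t) := by
  have hle {z : ℂ} (hz : z ∈ numRange (exA t)) : ‖exPhi t z‖ ≤ 1 := by
    rw [numRange_exA, mem_closedBall_zero_iff] at hz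
    rw [norm_exPhi]
    exact div_le_one_of_le₀ hz (exR_pos t).le
  have hd {z : ℂ} (hz : z ∈ numRange (exA t)) : DifferentiableAt ℂ (B ∘ exPhi t) z :=
    (hB.differentiableAt (hle hz)).comp z (by unfold exPhi; fun_prop)
  exact ⟨fun z hz => (hd hz).continuousAt.continuousWithinAt,
    fun z hz => (hd (interior_subset hz)).differentiableWithinAt,
    fun z hz => hB.norm_le_one (hle hz)⟩

theorem norm_matFun_id_comp_exPhi {t : ℝ} (ht : t ∈ Set.Icc (0 : ℝ) (√3 - 1)) :
    ‖matFun ((fun z => z) ∘ exPhi t) (exA t)‖ = 1 / exR t := by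
  have e : (fun z => z) ∘ exPhi t = exPhi t := rfl
  rw [e, matFun_exPhi (ne_one_of_mem_Icc ht), norm_smul,
    norm_exA ht.1 (ht.2.trans sqrt_three_sub_one_lt_one.le), norm_div, norm_one,
    Complex.norm_real, Real.norm_eq_abs, abs_of_pos (exR_pos t), mul_one]

theorem norm_matFun_sq_comp_exPhi {t : ℝ} (ht : t ∈ Set.Icc (0 : ℝ) (√3 - 1)) :
    ‖matFun ((fun z => z ^ 2) ∘ exPhi t) (exA t)‖ = (1 - t) / exR t ^ 2 := by
  rw [matFun_exA (ne_one_of_mem_Icc ht), deriv_comp_exPhi, iteratedDeriv_two_comp_exPhi]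
  have h1 : deriv (fun z : ℂ => z ^ 2) 0 = 0 := by simp
  have h2 : iteratedDeriv 2 (fun z : ℂ => z ^ 2) 0 = 2 := by simp
  rw [h1, h2]
  simp [exPhi, norm_smul, norm_exA_sq (ht.2.trans sqrt_three_sub_one_lt_one.le),
    abs_of_pos (exR_pos t)]
  ring

/-! ### Extremal Blaschke products -/

theorem isBlaschke_id : IsBlaschke 1 fun z => z := by simpa using isBlaschke_pow 1

theorem isExtremalBlaschke_sq {t : ℝ} (ht : t ∈ Set.Icc (0 : ℝ) (√3 - 1))
    (h : t ≤ 1 - 1 / √3) : IsExtremalBlaschke (exA t) (exPhi t) 2 (fun z => z ^ 2) := by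
  refine ⟨isBlaschke_pow 2, (isBlaschke_pow 2).comp_exPhi_mem_admissible t, fun f hf => ?_⟩
  have hle := norm_matFun_exA_le ht hf
  rw [max_eq_right (not_lt.1 fun hlt => (not_lt.2 h)
    ((one_sub_div_exR_sq_lt_iff (ht.2.trans_lt sqrt_three_sub_one_lt_one)).1 hlt))] at hle
  rwa [norm_matFun_sq_comp_exPhi ht]

theorem isExtremalBlaschke_id {t : ℝ} (ht : t ∈ Set.Icc (0 : ℝ) (√3 - 1))
    (h : 1 - 1 / √3 ≤ t) : IsExtremalBlaschke (exA t) (exPhi t) 1 (fun z => z) := by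
  refine ⟨isBlaschke_id, isBlaschke_id.comp_exPhi_mem_admissible t, fun f hf => ?_⟩
  have hle := norm_matFun_exA_le ht hf
  rw [max_eq_left (not_lt.1 fun hlt => (not_lt.2 h)
    ((one_div_exR_lt_iff (ht.2.trans_lt sqrt_three_sub_one_lt_one)).1 hlt))] at hle
  rwa [norm_matFun_id_comp_exPhi ht]

theorem IsExtremalBlaschke.eq_sq {t : ℝ} (ht : t ∈ Set.Icc (0 : ℝ) (√3 - 1))
    (h : t < 1 - 1 / √3) {m : ℕ} {B : ℂ → ℂ} (hB : IsExtremalBlaschke (exA t) (exPhi t) m B) :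
    m = 2 ∧ EqUpToUnimodular B (fun z => z ^ 2) := by
  have hlt := (one_div_exR_lt_iff (ht.2.trans_lt sqrt_three_sub_one_lt_one)).2 h
  have hge := hB.2.2 _ (isExtremalBlaschke_sq ht h.le).2.1
  have hle := norm_matFun_exA_le ht hB.2.1
  rw [norm_matFun_sq_comp_exPhi ht] at hge
  rw [max_eq_right hlt.le] at hle
  obtain ⟨h0, h1, h2⟩ := taylor_of_norm_matFun_eq_sq ht hlt hB.2.1 (le_antisymm hle hge)
  have hr : (1 / exR t : ℂ) ≠ 0 := by simpa using (exR_pos t).ne'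
  rw [deriv_comp_exPhi, mul_eq_zero, or_iff_right hr] at h1
  -- The chain rule factor `1/r²` cancels, leaving a unimodular second Taylor coefficient of `B`
  -- itself.
  have hn : ‖(1 / exR t : ℂ) ^ 2‖ = (1 / exR t) ^ 2 := by simp
  rw [iteratedDeriv_two_comp_exPhi, mul_div_assoc, norm_mul, hn,
    mul_eq_left₀ (pow_ne_zero 2 (one_div_pos.2 (exR_pos t)).ne')] at h2
  obtain ⟨hm, c, hc, hcB⟩ := hB.1.eq_const_mul_sq (by simpa [exPhi] using h0) h1 h2
  exact ⟨hm, c, hc, fun z _ => hcB z⟩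

theorem IsExtremalBlaschke.eq_id {t : ℝ} (ht : t ∈ Set.Icc (0 : ℝ) (√3 - 1))
    (h : 1 - 1 / √3 < t) {m : ℕ} {B : ℂ → ℂ} (hB : IsExtremalBlaschke (exA t) (exPhi t) m B) :
    m = 1 ∧ EqUpToUnimodular B (fun z => z) := by
  have hlt := (one_sub_div_exR_sq_lt_iff (ht.2.trans_lt sqrt_three_sub_one_lt_one)).2 h
  have hge := hB.2.2 _ (isExtremalBlaschke_id ht h.le).2.1
  have hle := norm_matFun_exA_le ht hB.2.1
  rw [norm_matFun_id_comp_exPhi ht] at hge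
  rw [max_eq_left hlt.le] at hle
  obtain ⟨h0, h1⟩ := taylor_of_norm_matFun_eq ht hlt hB.2.1 (le_antisymm hle hge)
  have hn : ‖(1 / exR t : ℂ)‖ = 1 / exR t := by simp [(exR_pos t).le]
  rw [deriv_comp_exPhi, norm_mul, hn, mul_eq_left₀ (one_div_pos.2 (exR_pos t)).ne'] at h1
  obtain ⟨hm, c, hc, hcB⟩ := hB.1.eq_const_mul_id (by simpa [exPhi] using h0) h1
  exact ⟨hm, c, hc, fun z _ => hcB z⟩

theorem not_eqUpToUnimodular_id_sq : ¬ EqUpToUnimodular (fun z => z) (fun z => z ^ 2) := by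
  rintro ⟨c, -, h⟩
  have h1 := h 1 (by simp)
  have h2 := h (-1) (by simp)
  norm_num at h1 h2
  rw [← h1] at h2
  norm_num at h2

theorem one_sub_one_div_sqrt_three_mem : 1 - 1 / √3 ∈ Set.Icc (0 : ℝ) (√3 - 1) := by
  have h3 : √3 ^ 2 = 3 := Real.sq_sqrt (by norm_num)
  have hpos : 0 < √3 := by positivity
  have he : 1 / √3 = √3 / 3 := by field_simp; linarith
  rw [he]
  constructor <;> nlinarith

theorem exR_one_sub_one_div_sqrt_three : exR (1 - 1 / √3) = 1 / √3 := by
  have h3 : (1 / √3) ^ 2 = 1 / 3 := by rw [div_pow, Real.sq_sqrt (by norm_num)]; norm_num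
  rw [← sq_eq_sq₀ (exR_pos _).le (by positivity), exR_sq, sub_sub_cancel, h3]
  norm_num

theorem exists_isBlaschke_norm_eq_max {t : ℝ} (ht : t ∈ Set.Icc (0 : ℝ) (√3 - 1)) :
    ∃ (m : ℕ) (B : ℂ → ℂ), IsBlaschke m B ∧
      max (1 / exR t) ((1 - t) / exR t ^ 2) = ‖matFun (B ∘ exPhi t) (exA t)‖ := by
  obtain h | h := le_total (1 / exR t) ((1 - t) / exR t ^ 2)
  · exact ⟨2, _, isBlaschke_pow 2, by rw [max_eq_right h, norm_matFun_sq_comp_exPhi ht]⟩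
  · exact ⟨1, _, isBlaschke_id, by rw [max_eq_left h, norm_matFun_id_comp_exPhi ht]⟩

theorem mainTheorem5 :
    (∀ t ∈ Set.Icc (0 : ℝ) (√3 - 1),
      -- `W(A)` is a disk and `φ` a conformal map of it, with `φ(A) = A / r`
      numRange (exA t) = Metric.closedBall 0 (exR t) ∧
      IsConformalOntoDisk (exPhi t) (numRange (exA t)) ∧
      matFun (exPhi t) (exA t) = (1 / (exR t : ℂ)) • exA t ∧
      -- `B(φ(A))` is the same matrix as `(B ∘ φ)(A)`
      (∀ (m : ℕ) (B : ℂ → ℂ), IsBlaschke m B →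
        matFun B (matFun (exPhi t) (exA t)) = matFun (B ∘ exPhi t) (exA t)) ∧
      -- the maximum over all Blaschke products, and over all admissible functions
      IsGreatest {x : ℝ | ∃ (m : ℕ) (B : ℂ → ℂ), IsBlaschke m B ∧
          x = ‖matFun B (matFun (exPhi t) (exA t))‖}
        (max (1 / exR t) ((1 - t) / exR t ^ 2)) ∧
      IsGreatest {x : ℝ | ∃ f ∈ admissible (exA t), x = ‖matFun f (exA t)‖}
        (max (1 / exR t) ((1 - t) / exR t ^ 2)) ∧
      -- the values at `z` and `z²`
      ‖matFun (fun z => z) (matFun (exPhi t) (exA t))‖ = 1 / exR t ∧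
      ‖matFun (fun z => z ^ 2) (matFun (exPhi t) (exA t))‖ = (1 - t) / exR t ^ 2 ∧
      -- `z²` is extremal for `t ≤ t₀`, and the only extremal Blaschke product for `t < t₀`
      (t ≤ 1 - 1 / √3 → IsExtremalBlaschke (exA t) (exPhi t) 2 (fun z => z ^ 2)) ∧
      (t < 1 - 1 / √3 → ∀ (m : ℕ) (B : ℂ → ℂ), IsExtremalBlaschke (exA t) (exPhi t) m B →
        m = 2 ∧ EqUpToUnimodular B (fun z => z ^ 2)) ∧
      -- `z` is extremal for `t ≥ t₀`, and the only extremal Blaschke product for `t > t₀`;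
      -- in particular the degree is then less than `n - 1 = 2`
      (1 - 1 / √3 ≤ t → IsExtremalBlaschke (exA t) (exPhi t) 1 (fun z => z)) ∧
      (1 - 1 / √3 < t → ∀ (m : ℕ) (B : ℂ → ℂ), IsExtremalBlaschke (exA t) (exPhi t) m B →
        m = 1 ∧ EqUpToUnimodular B (fun z => z))) ∧
    -- at `t₀`, which lies in the interval, both are extremal with value `√3`: no uniqueness
    (1 - 1 / √3 ∈ Set.Icc (0 : ℝ) (√3 - 1) ∧
      IsExtremalBlaschke (exA (1 - 1 / √3)) (exPhi (1 - 1 / √3)) 1 (fun z => z) ∧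
      IsExtremalBlaschke (exA (1 - 1 / √3)) (exPhi (1 - 1 / √3)) 2 (fun z => z ^ 2) ∧
      ‖matFun (fun z => z) (matFun (exPhi (1 - 1 / √3)) (exA (1 - 1 / √3)))‖ = √3 ∧
      ‖matFun (fun z => z ^ 2) (matFun (exPhi (1 - 1 / √3)) (exA (1 - 1 / √3)))‖ = √3 ∧
      ¬ EqUpToUnimodular (fun z => z) (fun z => z ^ 2) ∧
      ¬ ExtremalBlaschkeUnique (exA (1 - 1 / √3)) (exPhi (1 - 1 / √3))) := by
  refine ⟨fun t ht => ?_, ?_⟩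
  · have hne := ne_one_of_mem_Icc ht
    obtain ⟨m, B, hB, hmax⟩ := exists_isBlaschke_norm_eq_max ht
    refine ⟨numRange_exA t, isConformalOntoDisk_exPhi t, matFun_exPhi hne,
      fun m B _ => matFun_matFun_exPhi hne B, ⟨⟨m, B, hB, ?_⟩, ?_⟩,
      ⟨⟨_, hB.comp_exPhi_mem_admissible t, hmax⟩, ?_⟩, ?_, ?_, isExtremalBlaschke_sq ht,
      fun h m B hB => hB.eq_sq ht h, isExtremalBlaschke_id ht, fun h m B hB => hB.eq_id ht h⟩
    · rw [matFun_matFun_exPhi hne, hmax]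
    · rintro x ⟨m, B, hB, rfl⟩
      rw [matFun_matFun_exPhi hne]
      exact norm_matFun_exA_le ht (hB.comp_exPhi_mem_admissible t)
    · rintro x ⟨f, hf, rfl⟩
      exact norm_matFun_exA_le ht hf
    · rw [matFun_matFun_exPhi hne, norm_matFun_id_comp_exPhi ht]
    · rw [matFun_matFun_exPhi hne, norm_matFun_sq_comp_exPhi ht]
  · have ht := one_sub_one_div_sqrt_three_mem
    have hne := ne_one_of_mem_Icc ht
    have h1 := isExtremalBlaschke_id ht le_rfl
    have h2 := isExtremalBlaschke_sq ht le_rfl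
    refine ⟨ht, h1, h2, ?_, ?_, not_eqUpToUnimodular_id_sq,
      fun h => not_eqUpToUnimodular_id_sq (h 1 2 _ _ h1 h2)⟩
    · rw [matFun_matFun_exPhi hne, norm_matFun_id_comp_exPhi ht, exR_one_sub_one_div_sqrt_three,
        one_div_one_div]
    · rw [matFun_matFun_exPhi hne, norm_matFun_sq_comp_exPhi ht, exR_one_sub_one_div_sqrt_three,
        sub_sub_cancel]
      field_simp
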